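/- Let $m,n\ge 1$ be integers and let $\mathbb{M}_n$ be the space of complex $n\times n$ matrices. For $Z\in\mathbb{M}_n$ put $\operatorname{Re}Z=\frac{Z+Z^*}{2}$, $\operatorname{Im}Z=\frac{Z-Z^*}{2i}$, and define the quadratic symmetric modulus of $Z$ as the positive semidefinite square root $$|Z|_{\mathrm{qsym}}:=\sqrt{(\operatorname{Re}Z)^2+(\operatorname{Im}Z)^2}.$$ A norm $\|\cdot\|$ on $\mathbb{M}_n$ is called unitarily invariant if $\|UZV\|=\|Z\|$ for all $Z\in\mathbb{M}_n$ and all unitary $U,V\in\mathbb{M}_n$. Then for all $A_1,\dots,A_m\in\mathbb{M}_n$ and every unitarily invariant norm $\|\cdot\|$ on $\mathbb{M}_n$, $$\Bigl\|\,\Bigl|\sum_{k=1}^m A_k\Bigr|_{\mathrm{qsym}}\Bigr\|\ \le\ \sqrt{\min\{m,2n\}}\;\Bigl\|\sum_{k=1}^m |A_k|_{\mathrm{qsym}}\Bigr\|.$$ -/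

import Mathlib

noncomputable section

open scoped MatrixOrder ComplexStarModule

/-- The quadratic symmetric modulus `|Z|_qsym = √((Re Z)² + (Im Z)²)` of a complex square matrix,
where `Re Z = (Z + Z*) / 2` and `Im Z = (Z - Z*) / (2i)` are the Cartesian parts of `Z` and `√` is
the positive semidefinite square root. -/
def qsymModulus {n : ℕ} (Z : Matrix (Fin n) (Fin n) ℂ) : Matrix (Fin n) (Fin n) ℂ :=
  CFC.sqrt ((ℜ Z : Matrix (Fin n) (Fin n) ℂ) ^ 2 + (ℑ Z : Matrix (Fin n) (Fin n) ℂ) ^ 2)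

/-- A seminorm `N` on `M_n(ℂ)` is a unitarily invariant norm: it is definite, and
`N (U Z V) = N Z` for all `Z` and all unitary matrices `U`, `V`. -/
structure IsUnitarilyInvariantNorm {n : ℕ} (N : Seminorm ℂ (Matrix (Fin n) (Fin n) ℂ)) : Prop where
  eq_zero_of_map_eq_zero : ∀ Z : Matrix (Fin n) (Fin n) ℂ, N Z = 0 → Z = 0
  map_unitary_mul_mul : ∀ U ∈ Matrix.unitaryGroup (Fin n) ℂ,
    ∀ V ∈ Matrix.unitaryGroup (Fin n) ℂ, ∀ Z : Matrix (Fin n) (Fin n) ℂ, N (U * Z * V) = N Z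

end

/-! The column `[Re Z; Im Z]` is additive in `Z` and has Gram matrix `|Z|²`, so Douglas
factorization in both directions gives `|∑ A k| = ∑ C k * P k` with `P k = |A k|` and contractions
`C k` (`exists_contraction_qsymModulus_sum`). Expanding `(t C k - 1) P k (t C k - 1)* ≥ 0` and
summing bounds `2t |∑ A k|` by `t² ∑ C k P k (C k)* + ∑ P k`. The norm is monotone and does not
increase under contractions, and `∑ N (P k) ≤ min(m, n) N (∑ P k)` (`sum_map_le`). Taking `t =
1/√min(m, n)` yields the constant `√min(m, n)`, sharper than required. -/

open scoped MatrixOrder ComplexStarModule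

/-! ### Factoring linear maps through one another -/

section Factorization

variable {E F G : Type*} [NormedAddCommGroup E] [InnerProductSpace ℂ E]
  [NormedAddCommGroup F] [InnerProductSpace ℂ F] [NormedAddCommGroup G] [InnerProductSpace ℂ G]

/-- If `‖a x‖ ≤ ‖b x‖` for all `x`, then `a` factors through `b` on the range of `b`. -/
theorem LinearMap.exists_range_factor_of_norm_le (a : E →ₗ[ℂ] F) (b : E →ₗ[ℂ] G)
    (h : ∀ x, ‖a x‖ ≤ ‖b x‖) :
    ∃ L : LinearMap.range b →ₗ[ℂ] F, ∀ x, L (b.rangeRestrict x) = a x := by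
  obtain ⟨g, hg⟩ := b.rangeRestrict.exists_rightInverse_of_surjective b.range_rangeRestrict
  refine ⟨a ∘ₗ g, fun x => ?_⟩
  have h1 : b (g (b.rangeRestrict x)) = b x :=
    congrArg Subtype.val (LinearMap.congr_fun hg (b.rangeRestrict x))
  -- Independence of the chosen preimage: the bound forces `ker b ≤ ker a`.
  have h2 : a (g (b.rangeRestrict x) - x) = 0 := by
    have := h (g (b.rangeRestrict x) - x)
    rw [map_sub b, h1, sub_self, norm_zero] at this
    exact norm_le_zero_iff.1 this
  rw [map_sub, sub_eq_zero] at h2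
  exact h2

theorem LinearMap.exists_contraction_factor [FiniteDimensional ℂ G] (a : E →ₗ[ℂ] F)
    (b : E →ₗ[ℂ] G) (h : ∀ x, ‖a x‖ ≤ ‖b x‖) :
    ∃ K : G →ₗ[ℂ] F, (∀ y, ‖K y‖ ≤ ‖y‖) ∧ a = K ∘ₗ b := by
  obtain ⟨L, hL⟩ := a.exists_range_factor_of_norm_le b h
  have hLn : ∀ y, ‖L y‖ ≤ ‖y‖ := by
    intro y
    obtain ⟨x, rfl⟩ := b.surjective_rangeRestrict y
    rw [hL]
    exact h x
  refine ⟨L ∘ₗ (LinearMap.range b).orthogonalProjectionOnto.toLinearMap, fun y => ?_, ?_⟩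
  · exact (hLn _).trans ((LinearMap.range b).norm_orthogonalProjectionOnto_apply_le y)
  · ext x
    have : (LinearMap.range b).orthogonalProjectionOnto (b x) = b.rangeRestrict x :=
      (LinearMap.range b).orthogonalProjectionOnto_mem_subspace_eq_self (b.rangeRestrict x)
    simp only [LinearMap.comp_apply, ContinuousLinearMap.coe_coe, this, hL]

theorem LinearMap.exists_isometry_factor [FiniteDimensional ℂ G] (a b : E →ₗ[ℂ] G)
    (h : ∀ x, ‖a x‖ = ‖b x‖) :
    ∃ K : G →ₗᵢ[ℂ] G, a = K.toLinearMap ∘ₗ b := by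
  obtain ⟨L, hL⟩ := a.exists_range_factor_of_norm_le b fun x => (h x).le
  have hLn : ∀ y, ‖L y‖ = ‖y‖ := by
    intro y
    obtain ⟨x, rfl⟩ := b.surjective_rangeRestrict y
    rw [hL]
    exact h x
  refine ⟨LinearIsometry.extend ⟨L, hLn⟩, ?_⟩
  ext x
  exact (hL x).symm.trans (LinearIsometry.extend_apply ⟨L, hLn⟩ (b.rangeRestrict x)).symm

end Factorization

open scoped ComplexOrder

/-! ### Contractions, Gram matrices and unitary means -/

namespace Matrix

variable {p q r : Type*} [Fintype p] [Fintype q] [Fintype r]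

theorem norm_sq_toEuclideanLin [DecidableEq r] (A : Matrix p r ℂ) (x : EuclideanSpace ℂ r) :
    ‖toEuclideanLin A x‖ ^ 2 = (star x.ofLp ⬝ᵥ ((Aᴴ * A) *ᵥ x.ofLp)).re := by
  rw [@norm_sq_eq_re_inner ℂ, EuclideanSpace.inner_eq_star_dotProduct, ofLp_toLpLin, toLin'_apply,
    dotProduct_comm, star_mulVec, ← dotProduct_mulVec, mulVec_mulVec]
  rfl

theorem conjTranspose_mul_self_le_iff [DecidableEq r] (A : Matrix p r ℂ) (B : Matrix q r ℂ) :
    Aᴴ * A ≤ Bᴴ * B ↔ ∀ x, ‖toEuclideanLin A x‖ ≤ ‖toEuclideanLin B x‖ := by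
  have key : ∀ x : EuclideanSpace ℂ r,
      (star x.ofLp ⬝ᵥ ((Bᴴ * B - Aᴴ * A) *ᵥ x.ofLp)).re =
        ‖toEuclideanLin B x‖ ^ 2 - ‖toEuclideanLin A x‖ ^ 2 := by
    intro x
    rw [norm_sq_toEuclideanLin, norm_sq_toEuclideanLin, sub_mulVec, dotProduct_sub, Complex.sub_re]
  have herm : (Bᴴ * B - Aᴴ * A).IsHermitian :=
    (isHermitian_conjTranspose_mul_self B).sub (isHermitian_conjTranspose_mul_self A)
  rw [le_iff]
  constructor
  · intro h x
    have h1 := h.re_dotProduct_nonneg x.ofLp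
    have h2 := key x
    simp only [RCLike.re_to_complex] at h1
    exact (pow_le_pow_iff_left₀ (norm_nonneg _) (norm_nonneg _) two_ne_zero).1 (by linarith)
  · intro h
    refine .of_dotProduct_mulVec_nonneg herm fun x => ?_
    have h2 := key (WithLp.toLp 2 x)
    have h3 := pow_le_pow_left₀ (norm_nonneg _) (h (WithLp.toLp 2 x)) 2
    rw [Complex.le_def]
    refine ⟨?_, ?_⟩
    · simp only [Complex.zero_re]
      exact (sub_nonneg.2 h3).trans h2.symm.le
    · exact (herm.im_star_dotProduct_mulVec_self x).symm

/-- **Douglas factorization**: if `A*A ≤ B*B` then `A = K B` for a contraction `K`. -/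
theorem exists_contraction_mul_eq [DecidableEq q] [DecidableEq r] {A : Matrix p r ℂ}
    {B : Matrix q r ℂ} (h : Aᴴ * A ≤ Bᴴ * B) :
    ∃ K : Matrix p q ℂ, Kᴴ * K ≤ 1 ∧ A = K * B := by
  obtain ⟨K, hK, hA⟩ := (toEuclideanLin A).exists_contraction_factor (toEuclideanLin B)
    ((conjTranspose_mul_self_le_iff A B).1 h)
  refine ⟨toEuclideanLin.symm K, ?_, ?_⟩
  · have : (1 : Matrix q q ℂ) = 1ᴴ * 1 := by simp
    rw [this, conjTranspose_mul_self_le_iff]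
    intro x
    simpa [toLpLin_one] using hK x
  · apply toEuclideanLin.injective
    rw [toLpLin_mul_same, LinearEquiv.apply_symm_apply, hA]

/-- Square matrices with the same Gram matrix differ by a unitary factor on the left. -/
theorem exists_unitary_mul_eq [DecidableEq p] {A B : Matrix p p ℂ} (h : Aᴴ * A = Bᴴ * B) :
    ∃ U ∈ unitaryGroup p ℂ, A = U * B := by
  obtain ⟨K, hA⟩ := (toEuclideanLin A).exists_isometry_factor (toEuclideanLin B)
    fun x => le_antisymm ((conjTranspose_mul_self_le_iff A B).1 h.le x)
      ((conjTranspose_mul_self_le_iff B A).1 h.ge x)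
  refine ⟨toEuclideanLin.symm K.toLinearMap, ?_, ?_⟩
  · rw [mem_unitaryGroup_iff', star_eq_conjTranspose]
    have h1 : (1 : Matrix p p ℂ) = 1ᴴ * 1 := by simp
    apply le_antisymm <;> rw [h1, conjTranspose_mul_self_le_iff] <;> intro x <;>
      simp [toLpLin_one]
  · apply toEuclideanLin.injective
    rw [toLpLin_mul_same, LinearEquiv.apply_symm_apply, hA]

theorem contraction_mul [DecidableEq q] [DecidableEq r] {K : Matrix p q ℂ} {L : Matrix q r ℂ}
    (hK : Kᴴ * K ≤ 1) (hL : Lᴴ * L ≤ 1) : (K * L)ᴴ * (K * L) ≤ 1 := by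
  have h1 : (Lᴴ * (1 - Kᴴ * K) * L).PosSemidef := (le_iff.1 hK).conjTranspose_mul_mul_same L
  have h2 := h1.add (le_iff.1 hL)
  have h3 : 1 - (K * L)ᴴ * (K * L) = Lᴴ * (1 - Kᴴ * K) * L + (1 - Lᴴ * L) := by
    simp only [conjTranspose_mul, Matrix.mul_sub, Matrix.sub_mul, Matrix.mul_one, Matrix.mul_assoc]
    abel
  rwa [le_iff, h3]

/-- In `(S - iR)(S + iR)` the cross terms cancel by commutation, leaving `S² + R²`. -/
theorem add_I_smul_mem_unitaryGroup [DecidableEq p] {S R : Matrix p p ℂ} (hS : Sᴴ = S)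
    (hR : Rᴴ = R) (hc : Commute S R) (h : S * S + R * R = 1) :
    S + Complex.I • R ∈ unitaryGroup p ℂ := by
  rw [mem_unitaryGroup_iff', star_eq_conjTranspose, conjTranspose_add, conjTranspose_smul, hS, hR,
    ← h]
  simp only [add_mul, mul_add, smul_mul_assoc, mul_smul_comm, Complex.star_def,
    Complex.conj_I, hc.eq]
  match_scalars <;> simp

/-- Every square contraction is the mean of two unitary matrices. -/
theorem exists_unitary_mean_of_contraction [DecidableEq p] {K : Matrix p p ℂ}
    (hK : Kᴴ * K ≤ 1) :
    ∃ V ∈ unitaryGroup p ℂ, ∃ W ∈ unitaryGroup p ℂ, K = (1 / 2 : ℂ) • (V + W) := by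
  have h0 : 0 ≤ Kᴴ * K := nonneg_iff_posSemidef.2 (posSemidef_conjTranspose_mul_self K)
  have h1 : 0 ≤ 1 - Kᴴ * K := sub_nonneg.2 hK
  set S := CFC.sqrt (Kᴴ * K)
  set R := CFC.sqrt (1 - Kᴴ * K) with hRdef
  have hS : Sᴴ = S := (nonneg_iff_posSemidef.1 (CFC.sqrt_nonneg _)).isHermitian.eq
  have hR : Rᴴ = R := (nonneg_iff_posSemidef.1 (CFC.sqrt_nonneg _)).isHermitian.eq
  have hSS : S * S = Kᴴ * K := CFC.sqrt_mul_sqrt_self _ h0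
  have hRR : R * R = 1 - Kᴴ * K := CFC.sqrt_mul_sqrt_self _ h1
  have hsum : S * S + R * R = 1 := by rw [hSS, hRR]; abel
  -- `R` is a function of `1 - S²`, hence commutes with `S`.
  have hc : Commute S R := by
    have hc' : Commute (1 - Kᴴ * K) S := by
      rw [← hSS]
      exact (Commute.one_left S).sub_left ((Commute.refl S).mul_left (Commute.refl S))
    rw [hRdef, CFC.sqrt]
    exact (hc'.cfcₙ_nnreal _).symm
  obtain ⟨U, hU, hKU⟩ := exists_unitary_mul_eq (A := K) (B := S) (by rw [hS, hSS])
  -- With the polar form `K = U S`, average `U (S + iR)` and `U (S - iR)`.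
  refine ⟨U * (S + Complex.I • R), mul_mem hU (add_I_smul_mem_unitaryGroup hS hR hc hsum),
    U * (S + Complex.I • -R), mul_mem hU (add_I_smul_mem_unitaryGroup hS ?_ hc.neg_right ?_),
    ?_⟩
  · rw [conjTranspose_neg, hR]
  · rw [neg_mul_neg, hsum]
  · rw [← mul_add, ← mul_smul_comm, hKU]
    congr 1
    module

theorem single_contraction [DecidableEq p] (i j : p) :
    (single i j (1 : ℂ))ᴴ * single i j (1 : ℂ) ≤ 1 := by
  rw [conjTranspose_single, single_mul_single_same, le_iff, star_one, one_mul, ← diagonal_one,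
    ← diagonal_single, diagonal_sub]
  refine .diagonal fun k => ?_
  by_cases h : k = j
  · simp [h]
  · simp [h]

end Matrix

/-! ### Inequalities for unitarily invariant norms -/

namespace IsUnitarilyInvariantNorm

open Matrix

variable {n : ℕ} {N : Seminorm ℂ (Matrix (Fin n) (Fin n) ℂ)}

theorem map_contraction_mul_le (hN : IsUnitarilyInvariantNorm N) {K : Matrix (Fin n) (Fin n) ℂ}
    (hK : Kᴴ * K ≤ 1) (X : Matrix (Fin n) (Fin n) ℂ) : N (K * X) ≤ N X := by
  obtain ⟨V, hV, W, hW, rfl⟩ := exists_unitary_mean_of_contraction hK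
  have h1 := hN.map_unitary_mul_mul V hV 1 (one_mem _) X
  have h2 := hN.map_unitary_mul_mul W hW 1 (one_mem _) X
  rw [mul_one] at h1 h2
  have h3 := map_add_le_add N (V * X) (W * X)
  rw [smul_mul_assoc, map_smul_eq_mul, add_mul]
  norm_num
  linarith

theorem map_mul_contraction_le (hN : IsUnitarilyInvariantNorm N) {K : Matrix (Fin n) (Fin n) ℂ}
    (hK : Kᴴ * K ≤ 1) (X : Matrix (Fin n) (Fin n) ℂ) : N (X * K) ≤ N X := by
  obtain ⟨V, hV, W, hW, rfl⟩ := exists_unitary_mean_of_contraction hK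
  have h1 := hN.map_unitary_mul_mul 1 (one_mem _) V hV X
  have h2 := hN.map_unitary_mul_mul 1 (one_mem _) W hW X
  rw [one_mul] at h1 h2
  have h3 := map_add_le_add N (X * V) (X * W)
  rw [mul_smul_comm, map_smul_eq_mul, mul_add]
  norm_num
  linarith

theorem map_mul_conjTranspose_contraction_le (hN : IsUnitarilyInvariantNorm N)
    {K : Matrix (Fin n) (Fin n) ℂ} (hK : Kᴴ * K ≤ 1) (X : Matrix (Fin n) (Fin n) ℂ) :
    N (X * Kᴴ) ≤ N X := by
  obtain ⟨V, hV, W, hW, rfl⟩ := exists_unitary_mean_of_contraction hK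
  have h1 := hN.map_unitary_mul_mul 1 (one_mem _) (star V) (Unitary.star_mem hV) X
  have h2 := hN.map_unitary_mul_mul 1 (one_mem _) (star W) (Unitary.star_mem hW) X
  rw [one_mul, star_eq_conjTranspose] at h1 h2
  have h3 := map_add_le_add N (X * Vᴴ) (X * Wᴴ)
  rw [conjTranspose_smul, conjTranspose_add, mul_smul_comm, map_smul_eq_mul, mul_add]
  norm_num
  linarith

theorem map_conj_contraction_le (hN : IsUnitarilyInvariantNorm N) {K : Matrix (Fin n) (Fin n) ℂ}
    (hK : Kᴴ * K ≤ 1) (X : Matrix (Fin n) (Fin n) ℂ) : N (K * X * Kᴴ) ≤ N X :=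
  (hN.map_mul_conjTranspose_contraction_le hK _).trans (hN.map_contraction_mul_le hK X)

/-- A unitarily invariant norm is monotone on positive semidefinite matrices. -/
theorem map_le_map_of_nonneg (hN : IsUnitarilyInvariantNorm N) {A B : Matrix (Fin n) (Fin n) ℂ}
    (hA : 0 ≤ A) (hAB : A ≤ B) : N A ≤ N B := by
  have hB : 0 ≤ B := hA.trans hAB
  have hSA : (CFC.sqrt A)ᴴ = CFC.sqrt A :=
    (nonneg_iff_posSemidef.1 (CFC.sqrt_nonneg A)).isHermitian.eq
  have hSB : (CFC.sqrt B)ᴴ = CFC.sqrt B :=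
    (nonneg_iff_posSemidef.1 (CFC.sqrt_nonneg B)).isHermitian.eq
  obtain ⟨K, hK, h⟩ := exists_contraction_mul_eq (A := CFC.sqrt A) (B := CFC.sqrt B) (by
    rwa [hSA, hSB, CFC.sqrt_mul_sqrt_self _ hA, CFC.sqrt_mul_sqrt_self _ hB])
  have hKA : A = K * B * Kᴴ := by
    calc A = CFC.sqrt A * (CFC.sqrt A)ᴴ := by rw [hSA, CFC.sqrt_mul_sqrt_self _ hA]
      _ = K * (CFC.sqrt B * CFC.sqrt B) * Kᴴ := by
        rw [h, conjTranspose_mul, hSB]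
        simp only [Matrix.mul_assoc]
      _ = K * B * Kᴴ := by rw [CFC.sqrt_mul_sqrt_self _ hB]
  rw [hKA]
  exact hN.map_conj_contraction_le hK B

theorem map_single_le (hN : IsUnitarilyInvariantNorm N) (i j : Fin n) :
    N (single i i 1) ≤ N (single j j 1) := by
  have h : (single i i 1 : Matrix (Fin n) (Fin n) ℂ) =
      single i j 1 * (single j j 1 * single j i 1) := by
    simp
  rw [h]
  exact (hN.map_contraction_mul_le (single_contraction i j) _).trans
    (hN.map_mul_contraction_le (single_contraction j i) _)

theorem map_finset_sum_le {ι : Type*} [Fintype ι] (f : ι → Matrix (Fin n) (Fin n) ℂ) :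
    N (∑ i, f i) ≤ ∑ i, N (f i) :=
  Finset.le_sum_of_subadditive N (map_zero N).le (map_add_le_add N) _ _

theorem map_eq_map_diagonal_eigenvalues (hN : IsUnitarilyInvariantNorm N)
    {P : Matrix (Fin n) (Fin n) ℂ} (hP : P.IsHermitian) :
    N P = N (diagonal fun i => (hP.eigenvalues i : ℂ)) := by
  conv_lhs => rw [hP.spectral_theorem, Unitary.conjStarAlgAut_apply]
  exact hN.map_unitary_mul_mul _ hP.eigenvectorUnitary.2 _
    (Unitary.star_mem hP.eigenvectorUnitary.2) _

/-- Diagonalize and apply the triangle inequality; all diagonal matrix units have the same norm. -/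
theorem map_le_trace_mul (hN : IsUnitarilyInvariantNorm N) {P : Matrix (Fin n) (Fin n) ℂ}
    (hP : P.PosSemidef) (j : Fin n) : N P ≤ P.trace.re * N (single j j 1) := by
  have hd : (diagonal fun i => (hP.isHermitian.eigenvalues i : ℂ)) =
      ∑ i, (hP.isHermitian.eigenvalues i : ℂ) • single i i (1 : ℂ) := by
    rw [← sum_single_eq_diagonal]
    simp
  have ht : P.trace.re = ∑ i, hP.isHermitian.eigenvalues i := by
    rw [hP.isHermitian.trace_eq_sum_eigenvalues]
    simp
  rw [hN.map_eq_map_diagonal_eigenvalues hP.isHermitian, hd, ht, Finset.sum_mul]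
  refine (map_finset_sum_le _).trans (Finset.sum_le_sum fun i _ => ?_)
  rw [map_smul_eq_mul, Complex.norm_real, Real.norm_of_nonneg (hP.eigenvalues_nonneg i)]
  exact mul_le_mul_of_nonneg_left (hN.map_single_le i j) (hP.eigenvalues_nonneg i)

/-- Compressing the diagonalized `P` to one diagonal entry shows that each of the `n` eigenvalues
times the norm of a matrix unit is at most `N P`. -/
theorem trace_mul_le (hN : IsUnitarilyInvariantNorm N) {P : Matrix (Fin n) (Fin n) ℂ}
    (hP : P.PosSemidef) (j : Fin n) : P.trace.re * N (single j j 1) ≤ n * N P := by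
  have ht : P.trace.re = ∑ i, hP.isHermitian.eigenvalues i := by
    rw [hP.isHermitian.trace_eq_sum_eigenvalues]
    simp
  have hc : (n : ℝ) * N P = ∑ _i : Fin n, N P := by simp
  rw [ht, Finset.sum_mul, hc]
  refine Finset.sum_le_sum fun i _ => ?_
  have h1 : single i i (1 : ℂ) * (diagonal fun i => (hP.isHermitian.eigenvalues i : ℂ)) =
      (hP.isHermitian.eigenvalues i : ℂ) • single i i (1 : ℂ) := by
    ext a b
    by_cases h : i = b
    · subst h
      simp [mul_diagonal, single_apply, mul_comm]
    · simp [mul_diagonal, h]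
  have h2 := hN.map_contraction_mul_le (single_contraction i i)
    (diagonal fun i => (hP.isHermitian.eigenvalues i : ℂ))
  rw [h1, ← hN.map_eq_map_diagonal_eigenvalues, map_smul_eq_mul, Complex.norm_real,
    Real.norm_of_nonneg (hP.eigenvalues_nonneg i)] at h2
  exact (mul_le_mul_of_nonneg_left (hN.map_single_le j i) (hP.eigenvalues_nonneg i)).trans h2

/-- The factor `m` comes from `P k ≤ ∑ P k`, the factor `n` from comparing `N` with the trace, which
is additive. -/
theorem sum_map_le (hN : IsUnitarilyInvariantNorm N) {m : ℕ}
    {P : Fin m → Matrix (Fin n) (Fin n) ℂ} (hP : ∀ k, 0 ≤ P k) :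
    ∑ k, N (P k) ≤ ((min m n : ℕ) : ℝ) * N (∑ k, P k) := by
  have hsum : (∑ k, P k).PosSemidef :=
    nonneg_iff_posSemidef.1 (Finset.sum_nonneg fun k _ => hP k)
  rcases min_choice m n with h | h
  · rw [h]
    have hc : (m : ℝ) * N (∑ k, P k) = ∑ _k : Fin m, N (∑ k, P k) := by simp
    rw [hc]
    exact Finset.sum_le_sum fun k _ => hN.map_le_map_of_nonneg (hP k)
      (Finset.single_le_sum (f := P) (fun k _ => hP k) (Finset.mem_univ k))
  · rw [h]
    rcases Nat.eq_zero_or_pos n with rfl | hn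
    · have hz : ∀ X : Matrix (Fin 0) (Fin 0) ℂ, N X = 0 := fun X => by
        rw [Subsingleton.elim X 0, map_zero]
      simp [hz]
    · refine le_trans ?_ (hN.trace_mul_le hsum ⟨0, hn⟩)
      rw [trace_sum, Complex.re_sum, Finset.sum_mul]
      exact Finset.sum_le_sum fun k _ =>
        hN.map_le_trace_mul (nonneg_iff_posSemidef.1 (hP k)) ⟨0, hn⟩

/-- If a positive semidefinite `H` is a sum of products `C k * P k` of contractions and positive
semidefinite matrices, then `‖H‖ ≤ √min(m, n) ‖∑ P k‖`. -/
theorem map_le_sqrt_mul_of_eq_sum (hN : IsUnitarilyInvariantNorm N) {m : ℕ}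
    {C P : Fin m → Matrix (Fin n) (Fin n) ℂ} (hC : ∀ k, (C k)ᴴ * C k ≤ 1) (hP : ∀ k, 0 ≤ P k)
    {H : Matrix (Fin n) (Fin n) ℂ} (hH : 0 ≤ H) (hsum : H = ∑ k, C k * P k) :
    N H ≤ √((min m n : ℕ) : ℝ) * N (∑ k, P k) := by
  have hPh : ∀ k, (P k)ᴴ = P k := fun k => (nonneg_iff_posSemidef.1 (hP k)).isHermitian.eq
  have hQ : N (∑ k, C k * P k * (C k)ᴴ) ≤ ((min m n : ℕ) : ℝ) * N (∑ k, P k) :=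
    (map_finset_sum_le _).trans ((Finset.sum_le_sum fun k _ =>
      hN.map_conj_contraction_le (hC k) (P k)).trans (hN.sum_map_le hP))
  have key : ∀ t : ℝ, 0 < t →
      2 * t * N H ≤ t ^ 2 * N (∑ k, C k * P k * (C k)ᴴ) + N (∑ k, P k) := by
    intro t ht
    have hle : ((2 * t : ℝ) : ℂ) • H ≤
        ((t ^ 2 : ℝ) : ℂ) • (∑ k, C k * P k * (C k)ᴴ) + ∑ k, P k := by
      have h2 : ((2 * t : ℝ) : ℂ) • H = (t : ℂ) • (H + Hᴴ) := by
        rw [(nonneg_iff_posSemidef.1 hH).isHermitian.eq, ← two_smul ℂ, smul_smul]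
        push_cast
        rw [mul_comm]
      rw [h2, hsum, conjTranspose_sum, ← Finset.sum_add_distrib, Finset.smul_sum, Finset.smul_sum,
        ← Finset.sum_add_distrib]
      refine Finset.sum_le_sum fun k _ => ?_
      have h3 := (nonneg_iff_posSemidef.1 (hP k)).mul_mul_conjTranspose_same ((t : ℂ) • C k - 1)
      rw [le_iff]
      convert h3 using 1
      simp only [conjTranspose_sub, conjTranspose_smul, conjTranspose_one, conjTranspose_mul, hPh,
        Matrix.mul_sub, Matrix.sub_mul, Matrix.mul_one, Matrix.one_mul, smul_mul_assoc,
        mul_smul_comm, Complex.star_def, Complex.conj_ofReal]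
      push_cast
      module
    have h0 : 0 ≤ ((2 * t : ℝ) : ℂ) • H :=
      nonneg_iff_posSemidef.2 ((nonneg_iff_posSemidef.1 hH).smul (by
        rw [Complex.zero_le_real]
        positivity))
    have h4 := (hN.map_le_map_of_nonneg h0 hle).trans (map_add_le_add N _ _)
    rwa [map_smul_eq_mul, map_smul_eq_mul, Complex.norm_real, Complex.norm_real,
      Real.norm_of_nonneg (by positivity), Real.norm_of_nonneg (by positivity)] at h4
  -- The choice `t = 1/√min(m, n)` needs a positive minimum; otherwise `H = 0`.
  rcases Nat.eq_zero_or_pos (min m n) with h0 | hpos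
  · have hH0 : N H = 0 := by
      rcases Nat.min_eq_zero_iff.1 h0 with rfl | rfl
      · simp [hsum]
      · rw [Subsingleton.elim H 0, map_zero]
    rw [hH0]
    positivity
  · set c : ℝ := ((min m n : ℕ) : ℝ) with hc
    have hc0 : 0 < c := by
      rw [hc]
      exact_mod_cast hpos
    have hs : 0 < √c := Real.sqrt_pos.2 hc0
    have h5 := key (√c)⁻¹ (inv_pos.2 hs)
    have h6 : (√c)⁻¹ ^ 2 * N (∑ k, C k * P k * (C k)ᴴ) ≤ N (∑ k, P k) := by
      rw [inv_pow, Real.sq_sqrt hc0.le, inv_mul_le_iff₀ hc0]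
      exact hQ
    have h7 : (√c)⁻¹ * N H ≤ N (∑ k, P k) := by linarith
    rwa [inv_mul_le_iff₀ hs] at h7

end IsUnitarilyInvariantNorm

/-! ### The quadratic symmetric modulus -/

section QsymModulus

open Matrix

variable {n : ℕ}

/-- The column `[Re Z; Im Z]` of the Cartesian parts of `Z`. -/
noncomputable def cartesianColumn (Z : Matrix (Fin n) (Fin n) ℂ) : Matrix (Fin n ⊕ Fin n) (Fin n) ℂ :=
  fromRows (ℜ Z : Matrix (Fin n) (Fin n) ℂ) (ℑ Z : Matrix (Fin n) (Fin n) ℂ)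

theorem cartesianColumn_sum {m : ℕ} (A : Fin m → Matrix (Fin n) (Fin n) ℂ) :
    cartesianColumn (∑ k, A k) = ∑ k, cartesianColumn (A k) := by
  ext i j
  rw [Matrix.sum_apply]
  rcases i with i | i <;>
    simp [cartesianColumn, Matrix.sum_apply]

theorem qsymModulus_nonneg (Z : Matrix (Fin n) (Fin n) ℂ) : 0 ≤ qsymModulus Z :=
  CFC.sqrt_nonneg _

theorem conjTranspose_mul_self_qsymModulus (Z : Matrix (Fin n) (Fin n) ℂ) :
    (qsymModulus Z)ᴴ * qsymModulus Z = (cartesianColumn Z)ᴴ * cartesianColumn Z := by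
  have hre : (ℜ Z : Matrix (Fin n) (Fin n) ℂ)ᴴ = ℜ Z := (ℜ Z).2
  have him : (ℑ Z : Matrix (Fin n) (Fin n) ℂ)ᴴ = ℑ Z := (ℑ Z).2
  have h : (cartesianColumn Z)ᴴ * cartesianColumn Z =
      (ℜ Z : Matrix (Fin n) (Fin n) ℂ) ^ 2 + (ℑ Z : Matrix (Fin n) (Fin n) ℂ) ^ 2 := by
    rw [cartesianColumn, conjTranspose_fromRows_eq_fromCols_conjTranspose, fromCols_mul_fromRows,
      hre, him, sq, sq]
  have h0 : 0 ≤ (ℜ Z : Matrix (Fin n) (Fin n) ℂ) ^ 2 + (ℑ Z : Matrix (Fin n) (Fin n) ℂ) ^ 2 := by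
    rw [← h]
    exact nonneg_iff_posSemidef.2 (posSemidef_conjTranspose_mul_self _)
  rw [(nonneg_iff_posSemidef.1 (qsymModulus_nonneg Z)).isHermitian.eq, h, qsymModulus,
    CFC.sqrt_mul_sqrt_self _ h0]

/-- Equal Gram matrices give `|∑ A k| = W [Re; Im]` for the sum and a column `V k |A k|` for each
term; additivity of the column gives `C k = W V k`, where the doubled dimension has disappeared. -/
theorem exists_contraction_qsymModulus_sum {m : ℕ} (A : Fin m → Matrix (Fin n) (Fin n) ℂ) :
    ∃ C : Fin m → Matrix (Fin n) (Fin n) ℂ, (∀ k, (C k)ᴴ * C k ≤ 1) ∧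
      qsymModulus (∑ k, A k) = ∑ k, C k * qsymModulus (A k) := by
  obtain ⟨W, hW, hWeq⟩ :=
    exists_contraction_mul_eq (conjTranspose_mul_self_qsymModulus (∑ k, A k)).le
  choose V hV hVeq using fun k =>
    exists_contraction_mul_eq (conjTranspose_mul_self_qsymModulus (A k)).ge
  refine ⟨fun k => W * V k, fun k => contraction_mul hW (hV k), ?_⟩
  rw [hWeq, cartesianColumn_sum, Matrix.mul_sum]
  refine Finset.sum_congr rfl fun k _ => ?_
  rw [Matrix.mul_assoc, ← hVeq k]

end QsymModulus

theorem mainTheorem7 {m n : ℕ} (A : Fin m → Matrix (Fin n) (Fin n) ℂ)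
    (N : Seminorm ℂ (Matrix (Fin n) (Fin n) ℂ)) (hN : IsUnitarilyInvariantNorm N) :
    N (qsymModulus (∑ k, A k)) ≤
      Real.sqrt ((min m (2 * n) : ℕ) : ℝ) * N (∑ k, qsymModulus (A k)) := by
  obtain ⟨C, hC, hsum⟩ := exists_contraction_qsymModulus_sum A
  refine (hN.map_le_sqrt_mul_of_eq_sum hC (fun k => qsymModulus_nonneg (A k))
    (qsymModulus_nonneg _) hsum).trans ?_
  refine mul_le_mul_of_nonneg_right (Real.sqrt_le_sqrt ?_) (apply_nonneg N _)
  exact_mod_cast (by omega : min m n ≤ min m (2 * n))
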